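/- Let $\alpha\in(0,1)$ and let $(X_k)_{k\ge 1}$ be i.i.d. nonnegative real random variables whose common law is in the domain of attraction of an $\alpha$-stable law, i.e. $\mathbb P[X_1\ge u]=L(u)u^{-\alpha}$ for all $u>0$, with $L$ slowly varying at infinity. For $N\ge 1$ put $\tilde a_N=\inf\{u\ge 0:\ \mathbb P[X_1\ge u]\le 1/N\}$. Let $(G_{N,k})_{N\ge 1,\,1\le k\le N}$ be a bounded triangular array of real numbers whose empirical measures $\nu_N=\frac1N\sum_{k=1}^N\delta_{G_{N,k}}$ converge weakly to a probability measure $\nu$ on $\mathbb R$, and let $$S_N=\frac1{\tilde a_N}\sum_{k=1}^N G_{N,k}X_k .$$ Let $C_\alpha^{-1}=\frac{\Gamma(2-\alpha)\cos(\pi\alpha/2)}{1-\alpha}$. For $\sigma>0$ and $\beta\in[-1,1]$ let $\mathrm{Stable}_\alpha(\sigma,\beta,0)$ be the law on $\mathbb R$ with characteristic function $$t\mapsto\exp\Big[-\sigma^\alpha|t|^\alpha\big(1-i\beta\,\mathrm{sign}(t)\tan(\tfrac{\pi\alpha}2)\big)\Big].$$ 1. If $\nu\ne\delta_0$, then $S_N$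 converges in distribution, as $N\to\infty$, to $\mathrm{Stable}_\alpha(\sigma,\beta,0)$, where $\sigma>0$ and $\beta\in[-1,1]$ are given by $$\sigma^\alpha=\frac1{C_\alpha}\int|x|^\alpha\,\nu(dx),\qquad \beta=\frac{\int|x|^\alpha\,\mathrm{sign}(x)\,\nu(dx)}{\int|x|^\alpha\,\nu(dx)} .$$ 2. If $\nu=\delta_0$, then $S_N$ converges in distribution to $0$. -/

import Mathlib

open MeasureTheory ProbabilityTheory Filter Topology
open scoped NNReal

/-- The constant `C_α`, given by `C_α⁻¹ = Γ(2 - α) cos(π α / 2) / (1 - α)`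
(which is the value of the improper integral of `sin x / x ^ α` over `(0, ∞)`). -/
noncomputable def stableConst (α : ℝ) : ℝ :=
  (Real.Gamma (2 - α) * Real.cos (Real.pi * α / 2) / (1 - α))⁻¹

/-- `IsStableLaw α σ β μ P`: the law `P` on the real line is the `Stable_α(σ, β, μ)` distribution,
`α ∈ (0, 2)`, `α ≠ 1`, with scale `σ > 0`, skewness `β ∈ [-1, 1]` and shift `μ`.
It is given by its characteristic function. -/
structure IsStableLaw (α σ β μ : ℝ) (P : Measure ℝ) : Prop where
  alpha_pos : 0 < α
  alpha_lt_two : α < 2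
  alpha_ne_one : α ≠ 1
  scale_pos : 0 < σ
  skewness_mem : β ∈ Set.Icc (-1 : ℝ) 1
  isProbabilityMeasure : IsProbabilityMeasure P
  charFun_eq : ∀ t : ℝ, charFun P t =
    Complex.exp (-((σ ^ α * |t| ^ α : ℝ) : ℂ) *
        (1 - Complex.I * ((β * Real.sign t * Real.tan (Real.pi * α / 2) : ℝ) : ℂ))
      + Complex.I * ((μ * t : ℝ) : ℂ))

/-- `L` is slowly varying at infinity: it is positive and measurable on a half-line, and
`L (t x) / L t → 1` as `t → ∞`, for every `x > 0`. -/
structure IsSlowlyVarying (L : ℝ → ℝ) : Prop where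
  pos_measurable : ∃ A : ℝ, (∀ t, A ≤ t → 0 < L t) ∧ Measurable ((Set.Ici A).domRestrict L)
  tendsto : ∀ x : ℝ, 0 < x → Tendsto (fun t : ℝ => L (t * x) / L t) atTop (𝓝 1)

/-- The law `P` (of a nonnegative random variable `X`) is in the domain of attraction of an
`α`-stable law, i.e. its tail is regularly varying: `P[X ≥ u] = L(u) / u ^ α` with `L` slowly
varying. -/
def HasRegularlyVaryingTail (α : ℝ) (P : Measure ℝ) : Prop :=
  ∃ L : ℝ → ℝ, IsSlowlyVarying L ∧ ∀ u : ℝ, 0 < u → P.real (Set.Ici u) = L u / u ^ α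

/-- The normalizing constant `ã_N = inf {u : P[X ≥ u] ≤ 1 / N}`, for the law `P` of a nonnegative
random variable `X`. The restriction to `u ≥ 0` changes nothing for `N ≥ 2`, since then every `u`
in the set is positive. -/
noncomputable def normalizer (P : Measure ℝ) (N : ℕ) : ℝ :=
  sInf {u : ℝ | 0 ≤ u ∧ P.real (Set.Ici u) ≤ 1 / (N : ℝ)}

/-- The empirical measure `ν_N = (1 / N) ∑_k δ_{G_{N,k}}` of the `N`-th row of a triangular array
(rows are indexed from `0` to `N - 1`). It is a probability measure for `N ≥ 1`, and `0` for
`N = 0`. -/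
noncomputable def empiricalMeasure (G : (N : ℕ) → Fin N → ℝ) (N : ℕ) : FiniteMeasure ℝ :=
  (N : ℝ≥0)⁻¹ • ∑ k : Fin N, (diracProba (G N k)).toFiniteMeasure

/-- The normalized sum `S_N = (1 / ã_N) ∑_k G_{N,k} X_k`, where `a N` stands for `ã_N`. -/
noncomputable def normalizedSum {Ω : Type*} (a : ℕ → ℝ) (G : (N : ℕ) → Fin N → ℝ)
    (X : ℕ → Ω → ℝ) (N : ℕ) (ω : Ω) : ℝ :=
  1 / a N * ∑ k : Fin N, G N k * X k ω

/-! Write `F` for the tail of `X 0`, `φ` for its characteristic function and `a_N` for the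
normalizer. By independence the characteristic function of `S_N` at `t` is the product over `k` of
`φ(t G_{N,k} / a_N)`, so everything rests on how fast `φ` approaches `1` near `0`. For a nonnegative
variable, Fubini turns `φ(s) - 1` into the integral of `i s e^{isy} F(y)`. After rescaling, `N (φ(s
/ a_N) - 1)` has weight `N F(a_N y)`, which tends to `y^{-α}`, so its limit should be `ψ(s) =
-Γ(1-α) (-is)^α`, the `stableExponent`. The limiting integral is not absolutely convergent at
infinity: it is cut at `R`, at a cost of order `R^{-α}` uniform in `s`, and on `(0, R]` the weights
converge in `L¹` by a Potter bound. Convergence is therefore uniform on bounded sets of `s`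
(`eventually_norm_charFun_sub_stableExponent_le`). As the `G_{N,k}` are bounded, the sum of the `φ(t
G_{N,k} / a_N) - 1` is the empirical average of `ψ(t G_{N,k})` up to `o(1)`, and weak convergence
gives the limit `∫ ψ(tx) ν(dx)`. Each term is `O(1/N)`, so the product tends to the exponential of
this integral. Lévy's theorem concludes; writing `ψ` in polar form yields `σ` and `β`. -/

/-! ### Regularly varying tails and the normalizer -/

/-- A Potter-type bound for an antitone function whose halving ratio is eventually bounded. -/
lemma potter_bound {F : ℝ → ℝ} (hF : Antitone F) (hF1 : ∀ u, F u ≤ 1) (hpos : ∀ u, 0 < F u)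
    {γ : ℝ} (hγ : 0 < γ) (h : ∀ᶠ t in atTop, F (t / 2) ≤ 2 ^ γ * F t) :
    ∃ C T : ℝ, 0 < C ∧ 0 < T ∧ ∀ u v, 0 < u → u ≤ v → T ≤ v → u ^ γ * F u ≤ C * (v ^ γ * F v) := by
  obtain ⟨T₀, hT₀⟩ := eventually_atTop.1 h
  set T := max T₀ 1 with hT
  have hT1 : 1 ≤ T := le_max_right _ _
  have hTp : 0 < T := by linarith
  have h2 : (1 : ℝ) ≤ 2 ^ γ := Real.one_le_rpow (by norm_num) hγ.le
  -- This value makes the case `v ≤ 2T` work; `C ≥ 2 ^ γ`, from `F ≤ 1`, serves the case `v / 2 ≤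
  -- u`.
  set C := 2 ^ γ / F (2 * T) with hC
  have hC2 : (2 : ℝ) ^ γ ≤ C := by
    rw [hC, le_div_iff₀ (hpos _)]
    exact mul_le_of_le_one_right (by positivity) (hF1 _)
  have hCp : 0 < C := by linarith
  refine ⟨C, T, hCp, hTp, ?_⟩
  -- Induction on the dyadic scale of `v`. Passing from `v / 2` to `v` does not enlarge `C`: the
  -- factor `2 ^ γ` lost on `F` is the one gained on `v ^ γ`.
  have key : ∀ n : ℕ, ∀ u v, 0 < u → u ≤ v → T ≤ v → v ≤ 2 ^ (n + 1) * T →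
      u ^ γ * F u ≤ C * (v ^ γ * F v) := by
    intro n
    induction n with
    | zero =>
      intro u v hu huv hTv hv
      have hv' : v ≤ 2 * T := by simpa using hv
      have e1 : u ^ γ * F u ≤ (2 * T) ^ γ :=
        (mul_le_of_le_one_right (by positivity) (hF1 u)).trans
          (Real.rpow_le_rpow hu.le (huv.trans hv') hγ.le)
      have e2 : T ^ γ * F (2 * T) ≤ v ^ γ * F v :=
        mul_le_mul (Real.rpow_le_rpow hTp.le hTv hγ.le) (hF hv') (hpos _).le
          (Real.rpow_nonneg (by linarith) _)
      calc u ^ γ * F u ≤ (2 * T) ^ γ := e1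
        _ = C * (T ^ γ * F (2 * T)) := by
          rw [Real.mul_rpow (by norm_num) hTp.le, hC]
          have := (hpos (2 * T)).ne'
          field_simp
        _ ≤ _ := mul_le_mul_of_nonneg_left e2 hCp.le
    | succ n ih =>
      intro u v hu huv hTv hv
      rcases le_total v (2 ^ (n + 1) * T) with h' | h'
      · exact ih u v hu huv hTv h'
      have hv2 : T ≤ v / 2 := by
        have : (2 : ℝ) ≤ 2 ^ (n + 1) := by
          rw [pow_succ]; nlinarith [one_le_pow₀ (M₀ := ℝ) (a := 2) (by norm_num) (n := n)]
        nlinarith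
      have hvp : 0 < v := by linarith
      have hh : F (v / 2) ≤ 2 ^ γ * F v := hT₀ v ((le_max_left _ _).trans hTv)
      rcases le_total (v / 2) u with h3 | h3
      · calc u ^ γ * F u ≤ v ^ γ * (2 ^ γ * F v) :=
              mul_le_mul (Real.rpow_le_rpow hu.le huv hγ.le) ((hF h3).trans hh) (hpos _).le
                (by positivity)
          _ = 2 ^ γ * (v ^ γ * F v) := by ring
          _ ≤ _ := mul_le_mul_of_nonneg_right hC2
            (mul_nonneg (by positivity) (hpos _).le)
      · calc u ^ γ * F u ≤ C * ((v / 2) ^ γ * F (v / 2)) := by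
              refine ih u (v / 2) hu h3 hv2 ?_
              rw [pow_succ] at hv; linarith
          _ ≤ C * ((v / 2) ^ γ * (2 ^ γ * F v)) := by gcongr
          _ = _ := by
            rw [Real.div_rpow hvp.le (by norm_num)]; field_simp
  intro u v hu huv hTv
  obtain ⟨n, hn⟩ := pow_unbounded_of_one_lt (v / T) (one_lt_two (α := ℝ))
  refine key n u v hu huv hTv ?_
  rw [div_lt_iff₀ hTp] at hn
  have : (2 : ℝ) ^ n ≤ 2 ^ (n + 1) := by
    rw [pow_succ]; linarith [pow_pos (two_pos (α := ℝ)) n]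
  nlinarith

lemma antitone_measureReal_Ici (P : Measure ℝ) [IsFiniteMeasure P] :
    Antitone fun u => P.real (Set.Ici u) :=
  fun _ _ h => measureReal_mono (Set.Ici_subset_Ici.2 h)

lemma HasRegularlyVaryingTail.tail_pos {α : ℝ} {P : Measure ℝ} [IsFiniteMeasure P]
    (h : HasRegularlyVaryingTail α P) (u : ℝ) : 0 < P.real (Set.Ici u) := by
  obtain ⟨L, ⟨⟨A, hA, -⟩, -⟩, hL⟩ := h
  set v := max u (max A 1)
  have hv : 0 < v := lt_of_lt_of_le one_pos ((le_max_right _ _).trans (le_max_right _ _))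
  refine lt_of_lt_of_le ?_ (antitone_measureReal_Ici P (le_max_left u (max A 1)))
  change 0 < P.real (Set.Ici v)
  rw [hL v hv]
  exact div_pos (hA v ((le_max_left _ _).trans (le_max_right _ _))) (Real.rpow_pos_of_pos hv _)

lemma HasRegularlyVaryingTail.tendsto_ratio {α : ℝ} {P : Measure ℝ}
    (h : HasRegularlyVaryingTail α P) {x : ℝ} (hx : 0 < x) :
    Tendsto (fun t => P.real (Set.Ici (t * x)) / P.real (Set.Ici t)) atTop (𝓝 (x ^ (-α))) := by
  obtain ⟨L, ⟨-, hS⟩, hL⟩ := h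
  have := (hS x hx).mul_const (x ^ (-α))
  rw [one_mul] at this
  refine this.congr' ?_
  filter_upwards [eventually_gt_atTop 0] with t ht
  rw [hL _ (mul_pos ht hx), hL _ ht, Real.mul_rpow ht.le hx.le, Real.rpow_neg hx.le]
  have := (Real.rpow_pos_of_pos ht α).ne'
  field_simp

lemma tendsto_measureReal_Ici_atTop (P : Measure ℝ) [IsFiniteMeasure P] :
    Tendsto (fun u => P.real (Set.Ici u)) atTop (𝓝 0) := by
  have := tendsto_measure_iInter_atTop (μ := P) (s := fun u : ℝ => Set.Ici u)
    (fun _ => measurableSet_Ici.nullMeasurableSet) (fun _ _ h => Set.Ici_subset_Ici.2 h)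
    ⟨0, measure_ne_top _ _⟩
  have h0 : (⋂ u : ℝ, Set.Ici u) = ∅ := by
    ext x
    simp only [Set.mem_iInter, Set.mem_Ici, Set.mem_empty_iff_false, iff_false, not_forall, not_le]
    exact ⟨x + 1, by linarith⟩
  rw [h0, measure_empty] at this
  exact (ENNReal.tendsto_toReal ENNReal.zero_ne_top).comp this

lemma exists_tail_le (P : Measure ℝ) [IsFiniteMeasure P] {ε : ℝ} (hε : 0 < ε) :
    ∃ u : ℝ, 0 ≤ u ∧ P.real (Set.Ici u) ≤ ε := by
  obtain ⟨u, h1, h2⟩ := (((tendsto_measureReal_Ici_atTop P).eventually_le_const hε).and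
    (eventually_ge_atTop 0)).exists
  exact ⟨u, h2, h1⟩

lemma tail_le_of_normalizer_lt (P : Measure ℝ) [IsFiniteMeasure P] {N : ℕ} (hN : 0 < N) {u : ℝ}
    (h : normalizer P N < u) : P.real (Set.Ici u) ≤ 1 / N := by
  obtain ⟨v, hv, hvu⟩ := exists_lt_of_csInf_lt
    (exists_tail_le P (ε := 1 / N) (by positivity)) h
  exact (antitone_measureReal_Ici P hvu.le).trans hv.2

lemma lt_tail_of_lt_normalizer (P : Measure ℝ) {N : ℕ} {u : ℝ} (hu : 0 ≤ u)
    (h : u < normalizer P N) : 1 / N < P.real (Set.Ici u) := by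
  by_contra! h'
  have : normalizer P N ≤ u := csInf_le ⟨0, fun _ h => h.1⟩ ⟨hu, h'⟩
  exact absurd this (not_le.2 h)

lemma HasRegularlyVaryingTail.tendsto_normalizer {α : ℝ} {P : Measure ℝ} [IsFiniteMeasure P]
    (h : HasRegularlyVaryingTail α P) : Tendsto (normalizer P) atTop atTop := by
  refine tendsto_atTop.2 fun K => ?_
  have h1 : Tendsto (fun N : ℕ => (1 : ℝ) / N) atTop (𝓝 0) := tendsto_one_div_atTop_nhds_zero_nat
  filter_upwards [h1.eventually_lt_const (h.tail_pos K), eventually_gt_atTop 0] with N hN hN0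
  by_contra! hK
  exact absurd (tail_le_of_normalizer_lt P hN0 hK) (not_le.2 hN)

/-- `F` may jump over the value `1 / N`. So `F(a_N x)` is compared with `1 / N` for `x` slightly
below or above `1`, and regular variation bounds the change from `F(a_N x)` to `F(a_N)` by a factor
close to `1`. -/
lemma HasRegularlyVaryingTail.tendsto_tail_normalizer {α : ℝ} {P : Measure ℝ} [IsFiniteMeasure P]
    (h : HasRegularlyVaryingTail α P) :
    Tendsto (fun N : ℕ => N * P.real (Set.Ici (normalizer P N))) atTop (𝓝 1) := by
  have ha := h.tendsto_normalizer
  have hc : Tendsto (fun x : ℝ => (x ^ (-α))⁻¹) (𝓝 1) (𝓝 1) := by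
    have : ContinuousAt (fun x : ℝ => (x ^ (-α))⁻¹) 1 :=
      (Real.continuousAt_rpow_const _ _ (Or.inl one_ne_zero)).inv₀ (by simp)
    simpa [ContinuousAt] using this
  rw [tendsto_order]
  constructor
  · intro c hc1
    obtain ⟨x, hx, hx0, hx1⟩ : ∃ x : ℝ, c < (x ^ (-α))⁻¹ ∧ 0 < x ∧ x < 1 := by
      have h1 := (hc.eventually_const_lt hc1).filter_mono (nhdsWithin_le_nhds (s := Set.Iio 1))
      have h2 : ∀ᶠ x : ℝ in 𝓝[<] 1, 0 < x ∧ x < 1 :=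
        Ioo_mem_nhdsLT one_pos
      exact (h1.and h2).exists
    have hr := ((h.tendsto_ratio hx0).comp ha).inv₀ (Real.rpow_pos_of_pos hx0 _).ne'
    filter_upwards [hr.eventually_const_lt hx, ha.eventually_gt_atTop 0, eventually_gt_atTop 0]
      with N h1 h2 h3
    refine h1.trans ?_
    have h4 := lt_tail_of_lt_normalizer P (N := N) (u := normalizer P N * x) (by positivity)
      (mul_lt_of_lt_one_right h2 hx1)
    have hN : (0 : ℝ) < N := by exact_mod_cast h3
    simp only [Function.comp, inv_div]
    rw [div_lt_iff₀ (h.tail_pos _)]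
    rw [div_lt_iff₀ hN] at h4
    nlinarith [h.tail_pos (normalizer P N)]
  · intro c hc1
    obtain ⟨x, hx, hx1⟩ : ∃ x : ℝ, (x ^ (-α))⁻¹ < c ∧ 1 < x := by
      have h1 := (hc.eventually_lt_const hc1).filter_mono (nhdsWithin_le_nhds (s := Set.Ioi 1))
      exact (h1.and self_mem_nhdsWithin).exists
    have hx0 : 0 < x := by linarith
    have hr := ((h.tendsto_ratio hx0).comp ha).inv₀ (Real.rpow_pos_of_pos hx0 _).ne'
    filter_upwards [hr.eventually_lt_const hx, ha.eventually_gt_atTop 0, eventually_gt_atTop 0]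
      with N h1 h2 h3
    refine lt_of_le_of_lt ?_ h1
    have h4 := tail_le_of_normalizer_lt P h3 (u := normalizer P N * x)
      (lt_mul_of_one_lt_right h2 hx1)
    have hN : (0 : ℝ) < N := by exact_mod_cast h3
    simp only [Function.comp, inv_div]
    rw [le_div_iff₀ (h.tail_pos _)]
    rw [le_div_iff₀ hN] at h4
    nlinarith [h.tail_pos (normalizer P N)]

lemma HasRegularlyVaryingTail.tendsto_tail_normalizer_mul {α : ℝ} {P : Measure ℝ}
    [IsFiniteMeasure P] (h : HasRegularlyVaryingTail α P) {x : ℝ} (hx : 0 < x) :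
    Tendsto (fun N : ℕ => N * P.real (Set.Ici (normalizer P N * x))) atTop (𝓝 (x ^ (-α))) := by
  have := h.tendsto_tail_normalizer.mul ((h.tendsto_ratio hx).comp h.tendsto_normalizer)
  rw [one_mul] at this
  refine this.congr fun N => ?_
  have := (h.tail_pos (normalizer P N)).ne'
  simp only [Function.comp]
  field_simp

/-- Convergence in `L¹(0, R]` of the rescaled tail. -/
lemma HasRegularlyVaryingTail.tendsto_integral_tail {α : ℝ} (hα : α ∈ Set.Ioo (0 : ℝ) 1)
    {P : Measure ℝ} [IsProbabilityMeasure P] (h : HasRegularlyVaryingTail α P)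
    {R : ℝ} (hR : 0 < R) :
    Tendsto (fun N : ℕ => ∫ x in (0 : ℝ)..R,
      |N * P.real (Set.Ici (normalizer P N * x)) - x ^ (-α)|) atTop (𝓝 0) := by
  -- `γ > α` puts the limiting halving ratio `2 ^ α` below `2 ^ γ`; `γ < 1` keeps `x ^ (-γ)`
  -- integrable at `0`.
  obtain ⟨γ, hγ⟩ := exists_between hα.2
  have hγ0 : 0 < γ := hα.1.trans hγ.1
  have ha := h.tendsto_normalizer
  have hhalf : ∀ᶠ t in atTop, P.real (Set.Ici (t / 2)) ≤ 2 ^ γ * P.real (Set.Ici t) := by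
    have := h.tendsto_ratio (x := 1 / 2) (by norm_num)
    have hlt : (1 / 2 : ℝ) ^ (-α) < 2 ^ γ := by
      rw [one_div, Real.inv_rpow (by norm_num), Real.rpow_neg (by norm_num), inv_inv]
      exact Real.rpow_lt_rpow_of_exponent_lt (by norm_num) hγ.1
    filter_upwards [this.eventually_lt_const hlt] with t ht
    rw [div_lt_iff₀ (h.tail_pos _)] at ht
    rw [show t / 2 = t * (1 / 2) by ring]
    exact ht.le
  obtain ⟨C, T, hC, hT, hpot⟩ := potter_bound (antitone_measureReal_Ici P)
    (fun u => measureReal_le_one) h.tail_pos hγ0 hhalf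
  have hev : ∀ᶠ N : ℕ in atTop, 0 < normalizer P N ∧ T ≤ normalizer P N * R ∧
      N * P.real (Set.Ici (normalizer P N * R)) ≤ R ^ (-α) + 1 :=
    (ha.eventually_gt_atTop 0).and (((ha.atTop_mul_const hR).eventually_ge_atTop T).and
      ((h.tendsto_tail_normalizer_mul hR).eventually_le_const (by linarith)))
  -- The Potter bound between `a_N x` and `a_N R` gives `N F(a_N x) ≤ D x ^ (-γ)`.
  set D := C * R ^ γ * (R ^ (-α) + 1)
  have hm (a : ℝ) : Measurable fun x => P.real (Set.Ici (a * x)) :=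
    ((antitone_measureReal_Ici P).measurable).comp (measurable_const_mul a)
  have := intervalIntegral.tendsto_integral_filter_of_dominated_convergence
    (μ := volume) (a := 0) (b := R) (l := (atTop : Filter ℕ))
    (F := fun N x => |N * P.real (Set.Ici (normalizer P N * x)) - x ^ (-α)|) (f := fun _ => 0)
    (fun x => D * x ^ (-γ) + x ^ (-α)) ?_ ?_ ?_ ?_
  · simpa using this
  · refine Eventually.of_forall fun N => Measurable.aestronglyMeasurable ?_
    exact (((hm _).const_mul _).sub (measurable_id.pow_const _)).norm
  · filter_upwards [hev] with N ⟨h1, h2, h3⟩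
    refine Eventually.of_forall fun x hx => ?_
    rw [Set.uIoc_of_le hR.le] at hx
    have hx0 := hx.1
    rw [Real.norm_eq_abs, abs_abs]
    refine (abs_sub _ _).trans ?_
    rw [abs_of_nonneg (by positivity), abs_of_nonneg (a := x ^ (-α)) (by positivity)]
    refine add_le_add ?_ le_rfl
    have h4 := hpot (normalizer P N * x) (normalizer P N * R) (by positivity)
      (by gcongr; exact hx.2) h2
    rw [Real.mul_rpow h1.le hx0.le, Real.mul_rpow h1.le hR.le] at h4
    have hap : 0 < normalizer P N ^ γ := by positivity
    have h5 : x ^ γ * P.real (Set.Ici (normalizer P N * x)) ≤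
        C * (R ^ γ * P.real (Set.Ici (normalizer P N * R))) := by
      refine le_of_mul_le_mul_left ?_ hap
      linarith
    rw [Real.rpow_neg hx0.le, ← div_eq_mul_inv, le_div_iff₀ (by positivity)]
    calc N * P.real (Set.Ici (normalizer P N * x)) * x ^ γ
        = N * (x ^ γ * P.real (Set.Ici (normalizer P N * x))) := by ring
      _ ≤ N * (C * (R ^ γ * P.real (Set.Ici (normalizer P N * R)))) := by gcongr
      _ = C * R ^ γ * (N * P.real (Set.Ici (normalizer P N * R))) := by ring
      _ ≤ _ := mul_le_mul_of_nonneg_left h3 (by positivity)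
  · exact ((intervalIntegral.intervalIntegrable_rpow' (by linarith [hγ.2])).const_mul _).add
      (intervalIntegral.intervalIntegrable_rpow' (by linarith [hα.2]))
  · refine Eventually.of_forall fun x hx => ?_
    rw [Set.uIoc_of_le hR.le] at hx
    have := ((h.tendsto_tail_normalizer_mul hx.1).sub_const (x ^ (-α))).abs
    simpa using this

/-! ### The Laplace transform of `x ^ (-α)` up to the imaginary axis -/

lemma integrableOn_exp_neg_mul_rpow {α : ℝ} (hα : α < 1) {r : ℝ} (hr : 0 < r) :
    IntegrableOn (fun x : ℝ => Real.exp (-r * x) * x ^ (-α)) (Set.Ioi 0) := by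
  have := integrableOn_rpow_mul_exp_neg_mul_rpow (s := -α) (p := 1) (by linarith) one_pos hr
  refine this.congr_fun (fun x _ => ?_) measurableSet_Ioi
  simp [mul_comm]

lemma integrableOn_cexp_neg_mul_rpow {α : ℝ} (hα : α < 1) {z : ℂ} (hz : 0 < z.re) :
    IntegrableOn (fun x : ℝ => Complex.exp (-z * x) * (x ^ (-α) : ℝ)) (Set.Ioi 0) := by
  refine Integrable.mono' (integrableOn_exp_neg_mul_rpow hα hz) ?_ ?_
  · refine Measurable.aestronglyMeasurable ?_
    fun_prop
  · refine (ae_restrict_iff' measurableSet_Ioi).2 (Eventually.of_forall fun x hx => ?_)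
    have hx0 : (0 : ℝ) < x := hx
    rw [norm_mul, Complex.norm_exp, Complex.norm_real, Real.norm_of_nonneg (by positivity)]
    simp

/-- The Laplace transform of `x ^ (-α)` on the right half-plane. -/
lemma integral_cexp_neg_mul_rpow {α : ℝ} (hα : α < 1) {z : ℂ} (hz : 0 < z.re) :
    ∫ x in Set.Ioi (0 : ℝ), Complex.exp (-z * x) * (x ^ (-α) : ℝ) =
      Complex.Gamma (1 - α) * z ^ ((α : ℂ) - 1) := by
  -- The transform is the complex moment generating function of this weighted measure at `-z`, hence
  -- analytic for `Re z > 0`. It equals the Gamma formula on the positive reals, which accumulate at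
  -- `1`, so the identity theorem applies.
  set m : Measure ℝ := (volume.restrict (Set.Ioi (0 : ℝ))).withDensity
    (fun x => ((x ^ (-α)).toNNReal : ENNReal)) with hm
  have hmeas : Measurable fun x : ℝ => (x ^ (-α)).toNNReal := by fun_prop
  have hset : ∀ t : ℝ, t < 0 → t ∈ integrableExpSet id m := by
    intro t ht
    change Integrable (fun x : ℝ => Real.exp (t * id x)) m
    rw [hm, integrable_withDensity_iff_integrable_smul hmeas]
    refine (integrableOn_exp_neg_mul_rpow hα (neg_pos.2 ht)).congr_fun
      (fun x hx => ?_) measurableSet_Ioi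
    have hx0 : (0 : ℝ) < x := hx
    simp only [NNReal.smul_def, Real.coe_toNNReal _ (Real.rpow_nonneg hx0.le (-α)), smul_eq_mul, id,
      neg_neg]
    ring
  have hint : ∀ t : ℝ, t < 0 → t ∈ interior (integrableExpSet id m) := fun t ht =>
    mem_interior.2 ⟨Set.Iio 0, fun t ht => hset t ht, isOpen_Iio, ht⟩
  have hval : ∀ w : ℂ, complexMGF id m (-w) =
      ∫ x in Set.Ioi (0 : ℝ), Complex.exp (-w * x) * (x ^ (-α) : ℝ) := by
    intro w
    rw [complexMGF, hm, integral_withDensity_eq_integral_smul hmeas]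
    refine setIntegral_congr_fun measurableSet_Ioi fun x hx => ?_
    have hx0 : (0 : ℝ) < x := hx
    simp only [NNReal.smul_def, Real.coe_toNNReal _ (Real.rpow_nonneg hx0.le (-α)), id,
      Complex.real_smul]
    ring
  have hU : IsOpen {w : ℂ | 0 < w.re} := isOpen_lt continuous_const Complex.continuous_re
  have hA : AnalyticOnNhd ℂ (fun w => complexMGF id m (-w)) {w : ℂ | 0 < w.re} := by
    intro w hw
    have h1 : AnalyticAt ℂ (complexMGF id m) (-w) :=
      analyticAt_complexMGF (hint _ (by simpa using hw))
    exact AnalyticAt.fun_comp h1 analyticAt_id.neg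
  have hB : AnalyticOnNhd ℂ (fun w : ℂ => Complex.Gamma (1 - α) * w ^ ((α : ℂ) - 1))
      {w : ℂ | 0 < w.re} := by
    intro w hw
    exact analyticAt_const.mul (analyticAt_id.cpow analyticAt_const (Or.inl hw))
  have hreal : ∀ r : ℝ, 0 < r →
      complexMGF id m (-(r : ℂ)) = Complex.Gamma (1 - α) * (r : ℂ) ^ ((α : ℂ) - 1) := by
    intro r hr
    rw [hval]
    have := Complex.integral_cpow_mul_exp_neg_mul_Ioi (a := 1 - α) (r := r) (by simpa using hα) hr
    rw [mul_comm, one_div, ← Complex.ofReal_inv, ← Complex.ofReal_one, ← Complex.ofReal_sub,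
      ← Complex.ofReal_cpow (by positivity), Real.inv_rpow hr.le, ← Real.rpow_neg hr.le,
      Complex.ofReal_cpow hr.le] at this
    push_cast at this
    rw [show -(1 - (α : ℂ)) = α - 1 by ring] at this
    rw [← this]
    refine setIntegral_congr_fun measurableSet_Ioi fun x hx => ?_
    have hx0 : (0 : ℝ) < x := hx
    rw [Complex.ofReal_cpow hx0.le, mul_comm, neg_mul]
    push_cast
    ring_nf
  have hpre : IsPreconnected {w : ℂ | 0 < w.re} :=
    (convex_halfSpace_re_gt 0).isPreconnected
  have hfreq : ∃ᶠ w in 𝓝[≠] (1 : ℂ), complexMGF id m (-w) =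
      Complex.Gamma (1 - α) * w ^ ((α : ℂ) - 1) := by
    have ht : Tendsto (fun r : ℝ => (r : ℂ)) (𝓝[≠] 1) (𝓝[≠] (1 : ℂ)) := by
      refine tendsto_nhdsWithin_iff.2 ⟨?_, ?_⟩
      · exact (Complex.continuous_ofReal.tendsto' 1 1 (by simp)).mono_left nhdsWithin_le_nhds
      · filter_upwards [self_mem_nhdsWithin] with r hr
        simpa using hr
    refine ht.frequently (Eventually.frequently ?_)
    filter_upwards [nhdsWithin_le_nhds (Ioi_mem_nhds (zero_lt_one (α := ℝ)))] with r hr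
    exact hreal r hr
  have := hA.eqOn_of_preconnected_of_frequently_eq hB hpre (z₀ := 1) (by simp) hfreq hz
  rw [← hval]
  exact this

/-- Integration by parts absorbs the factor `z`. The boundary term and the integral of `α x ^ (-α -
1)` contribute `R ^ (-α)` each. The bound does not depend on `z`, so it survives `Re z → 0`. -/
lemma norm_integral_Ioi_cexp_neg_mul_rpow_le {α : ℝ} (hα : α ∈ Set.Ioo (0 : ℝ) 1) {z : ℂ}
    (hz : 0 < z.re) {R : ℝ} (hR : 0 < R) :
    ‖z * ∫ x in Set.Ioi R, Complex.exp (-z * x) * (x ^ (-α) : ℝ)‖ ≤ 2 * R ^ (-α) := by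
  have hsub : Set.Ioi R ⊆ Set.Ioi 0 := Set.Ioi_subset_Ioi hR.le
  have i1 := (integrableOn_cexp_neg_mul_rpow hα.2 hz).mono_set hsub
  have ir : IntegrableOn (fun x : ℝ => x ^ (-α - 1)) (Set.Ioi R) :=
    integrableOn_Ioi_rpow_of_lt (by linarith [hα.1]) hR
  have hle : ∀ x ∈ Set.Ioi R, ‖Complex.exp (-z * x) * (x ^ (-α - 1) : ℝ)‖ ≤ x ^ (-α - 1) := by
    intro x hx
    have hx0 : 0 < x := hR.trans hx
    rw [norm_mul, Complex.norm_exp, Complex.norm_real, Real.norm_of_nonneg (by positivity)]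
    refine mul_le_of_le_one_left (by positivity) (Real.exp_le_one_iff.2 ?_)
    simp only [neg_mul, Complex.neg_re, Complex.mul_re, Complex.ofReal_re, Complex.ofReal_im,
      mul_zero, sub_zero, Left.neg_nonpos_iff]
    positivity
  have i2 : IntegrableOn (fun x : ℝ => Complex.exp (-z * x) * (x ^ (-α - 1) : ℝ)) (Set.Ioi R) := by
    refine Integrable.mono' ir (Measurable.aestronglyMeasurable (by fun_prop)) ?_
    exact (ae_restrict_iff' measurableSet_Ioi).2 (Eventually.of_forall hle)
  have hderiv : ∀ x ∈ Set.Ici R, HasDerivAt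
      (fun x : ℝ => -(Complex.exp (-z * x) * (x ^ (-α) : ℝ)))
      (z * (Complex.exp (-z * x) * (x ^ (-α) : ℝ)) +
        α * (Complex.exp (-z * x) * (x ^ (-α - 1) : ℝ))) x := by
    intro x hx
    have hx0 : 0 < x := hR.trans_le hx
    have h1 : HasDerivAt (fun x : ℝ => Complex.exp (-z * x)) (Complex.exp (-z * x) * (-z * 1)) x :=
      (((Complex.ofRealCLM.hasDerivAt (x := x)).const_mul (-z)).cexp)
    have h2 := (Real.hasDerivAt_rpow_const (p := -α) (Or.inl hx0.ne')).ofReal_comp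
    refine (h1.mul h2).neg.congr_deriv ?_
    push_cast
    ring
  have htend : Tendsto (fun x : ℝ => -(Complex.exp (-z * x) * (x ^ (-α) : ℝ))) atTop (𝓝 0) := by
    rw [← neg_zero]
    refine (squeeze_zero_norm' ?_ (tendsto_rpow_neg_atTop hα.1)).neg
    filter_upwards [eventually_gt_atTop 0] with x hx0
    rw [norm_mul, Complex.norm_exp, Complex.norm_real, Real.norm_of_nonneg (by positivity)]
    refine mul_le_of_le_one_left (by positivity) (Real.exp_le_one_iff.2 ?_)
    simp only [neg_mul, Complex.neg_re, Complex.mul_re, Complex.ofReal_re, Complex.ofReal_im,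
      mul_zero, sub_zero, Left.neg_nonpos_iff]
    positivity
  have hint := integral_Ioi_of_hasDerivAt_of_tendsto' hderiv
    ((i1.const_mul z).add (i2.const_mul (α : ℂ))) htend
  rw [integral_add (i1.const_mul z) (i2.const_mul (α : ℂ)), integral_const_mul,
    integral_const_mul] at hint
  have heq : z * ∫ x in Set.Ioi R, Complex.exp (-z * x) * (x ^ (-α) : ℝ) =
      Complex.exp (-z * R) * (R ^ (-α) : ℝ) -
        α * ∫ x in Set.Ioi R, Complex.exp (-z * x) * (x ^ (-α - 1) : ℝ) := by
    rw [eq_sub_iff_add_eq, hint]; ring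
  have b1 : ‖Complex.exp (-z * R) * (R ^ (-α) : ℝ)‖ ≤ R ^ (-α) := by
    rw [norm_mul, Complex.norm_exp, Complex.norm_real, Real.norm_of_nonneg (by positivity)]
    refine mul_le_of_le_one_left (by positivity) (Real.exp_le_one_iff.2 ?_)
    simp only [neg_mul, Complex.neg_re, Complex.mul_re, Complex.ofReal_re, Complex.ofReal_im,
      mul_zero, sub_zero, Left.neg_nonpos_iff]
    positivity
  have b2 : ‖(α : ℂ) * ∫ x in Set.Ioi R, Complex.exp (-z * x) * (x ^ (-α - 1) : ℝ)‖
      ≤ R ^ (-α) := by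
    have h3 := norm_integral_le_of_norm_le ir
      ((ae_restrict_iff' measurableSet_Ioi).2 (Eventually.of_forall hle))
    rw [integral_Ioi_rpow_of_lt (by linarith [hα.1]) hR, show -α - 1 + 1 = -α by ring,
      neg_div_neg_eq] at h3
    rw [norm_mul, Complex.norm_real, Real.norm_of_nonneg hα.1.le]
    calc _ ≤ α * (R ^ (-α) / α) := mul_le_mul_of_nonneg_left h3 hα.1.le
      _ = _ := by have := hα.1.ne'; field_simp
  rw [heq]
  refine (norm_sub_le _ _).trans ?_
  linarith

/-- The exponent of the totally skewed `α`-stable characteristic function. -/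
noncomputable def stableExponent (α s : ℝ) : ℂ :=
  -(Complex.Gamma (1 - α) * (-(Complex.I * s)) ^ (α : ℂ))

lemma norm_cpow_sub_integral_le {α : ℝ} (hα : α ∈ Set.Ioo (0 : ℝ) 1) {z : ℂ}
    (hz : 0 < z.re) {R : ℝ} (hR : 0 < R) :
    ‖Complex.Gamma (1 - α) * z ^ (α : ℂ) -
      z * ∫ x in (0 : ℝ)..R, Complex.exp (-z * x) * (x ^ (-α) : ℝ)‖ ≤ 2 * R ^ (-α) := by
  have hz0 : z ≠ 0 := by rintro rfl; simp at hz
  have h1 := integrableOn_cexp_neg_mul_rpow hα.2 hz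
  have hsplit : ∫ x in Set.Ioi (0 : ℝ), Complex.exp (-z * x) * (x ^ (-α) : ℝ) =
      (∫ x in (0 : ℝ)..R, Complex.exp (-z * x) * (x ^ (-α) : ℝ)) +
        ∫ x in Set.Ioi R, Complex.exp (-z * x) * (x ^ (-α) : ℝ) := by
    rw [intervalIntegral.integral_of_le hR.le, ← setIntegral_union
      (Set.Ioc_disjoint_Ioi le_rfl) measurableSet_Ioi (h1.mono_set Set.Ioc_subset_Ioi_self)
      (h1.mono_set (Set.Ioi_subset_Ioi hR.le)), Set.Ioc_union_Ioi_eq_Ioi hR.le]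
  have h2 : Complex.Gamma (1 - α) * z ^ (α : ℂ) =
      z * ∫ x in Set.Ioi (0 : ℝ), Complex.exp (-z * x) * (x ^ (-α) : ℝ) := by
    rw [integral_cexp_neg_mul_rpow hα.2 hz, Complex.cpow_sub _ _ hz0, Complex.cpow_one]
    field_simp
  rw [h2, hsplit, mul_add, add_sub_cancel_left]
  exact norm_integral_Ioi_cexp_neg_mul_rpow_le hα hz hR

/-- Abel summation: the bound holds at `z = ε - i s`, and `ε ↓ 0` is harmless on the bounded
interval. For `s ≠ 0` the limit point avoids the branch cut; for `s = 0` both terms vanish. -/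
lemma norm_stableExponent_sub_integral_le {α : ℝ} (hα : α ∈ Set.Ioo (0 : ℝ) 1) (s : ℝ) {R : ℝ}
    (hR : 0 < R) :
    ‖stableExponent α s - ∫ x in (0 : ℝ)..R,
      Complex.I * s * Complex.exp (Complex.I * s * x) * (x ^ (-α) : ℝ)‖ ≤ 2 * R ^ (-α) := by
  rcases eq_or_ne s 0 with rfl | hs
  · have : (α : ℂ) ≠ 0 := by exact_mod_cast hα.1.ne'
    simp only [stableExponent, Complex.ofReal_zero, mul_zero, neg_zero, zero_mul,
      intervalIntegral.integral_zero, sub_zero, Complex.zero_cpow this, norm_zero]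
    positivity
  have hz : Tendsto (fun ε : ℝ => (ε : ℂ) - Complex.I * s) (𝓝[>] 0) (𝓝 (-(Complex.I * s))) := by
    have : Continuous fun ε : ℝ => (ε : ℂ) - Complex.I * s := by fun_prop
    exact (this.tendsto' 0 _ (by simp)).mono_left nhdsWithin_le_nhds
  have hcpow : Tendsto (fun ε : ℝ => ((ε : ℂ) - Complex.I * s) ^ (α : ℂ)) (𝓝[>] 0)
      (𝓝 ((-(Complex.I * s)) ^ (α : ℂ))) :=
    (continuousAt_cpow_const (Or.inr (by simpa using hs))).tendsto.comp hz
  have hI : Tendsto (fun ε : ℝ => ∫ x in (0 : ℝ)..R,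
      Complex.exp (-((ε : ℂ) - Complex.I * s) * x) * (x ^ (-α) : ℝ)) (𝓝[>] 0)
      (𝓝 (∫ x in (0 : ℝ)..R, Complex.exp (-(-(Complex.I * s)) * x) * (x ^ (-α) : ℝ))) := by
    refine intervalIntegral.tendsto_integral_filter_of_dominated_convergence
      (fun x => x ^ (-α)) ?_ ?_ ?_ ?_
    · exact Eventually.of_forall fun ε => Measurable.aestronglyMeasurable (by fun_prop)
    · filter_upwards [self_mem_nhdsWithin] with ε hε
      refine Eventually.of_forall fun x hx => ?_
      rw [Set.uIoc_of_le hR.le] at hx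
      have hx0 := hx.1
      have hε0 : 0 < ε := hε
      rw [norm_mul, Complex.norm_exp, Complex.norm_real, Real.norm_of_nonneg (by positivity)]
      refine mul_le_of_le_one_left (by positivity) (Real.exp_le_one_iff.2 ?_)
      simp
      positivity
    · exact intervalIntegral.intervalIntegrable_rpow' (by linarith [hα.2])
    · refine Eventually.of_forall fun x _ => Tendsto.mul_const _ ?_
      exact (Complex.continuous_exp.tendsto _).comp (hz.neg.mul_const _)
  have hlim := ((hcpow.const_mul (Complex.Gamma (1 - α))).sub (hz.mul hI)).norm
  have hb : ∀ᶠ ε : ℝ in 𝓝[>] 0, ‖Complex.Gamma (1 - α) * ((ε : ℂ) - Complex.I * s) ^ (α : ℂ) -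
      ((ε : ℂ) - Complex.I * s) * ∫ x in (0 : ℝ)..R,
        Complex.exp (-((ε : ℂ) - Complex.I * s) * x) * (x ^ (-α) : ℝ)‖ ≤ 2 * R ^ (-α) := by
    filter_upwards [self_mem_nhdsWithin] with ε hε
    exact norm_cpow_sub_integral_le hα (by simpa using hε) hR
  have := le_of_tendsto hlim hb
  rw [← norm_neg] at this
  have e : (fun x : ℝ => Complex.I * s * Complex.exp (Complex.I * s * x) * (x ^ (-α) : ℝ)) =
      fun x : ℝ => Complex.I * s * (Complex.exp (Complex.I * s * x) * (x ^ (-α) : ℝ)) := by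
    ext x; ring
  rw [e, intervalIntegral.integral_const_mul, stableExponent]
  simp only [neg_neg] at this
  refine le_of_eq_of_le (congrArg norm ?_) this
  ring

/-! ### Characteristic functions through tails -/

lemma integral_I_mul_cexp (s m : ℝ) :
    ∫ y in (0 : ℝ)..m, Complex.I * s * Complex.exp (Complex.I * s * y) =
      Complex.exp (Complex.I * s * m) - 1 := by
  have h : ∀ y ∈ Set.uIcc 0 m, HasDerivAt (fun y : ℝ => Complex.exp (Complex.I * s * y))
      (Complex.I * s * Complex.exp (Complex.I * s * y)) y := by
    intro y _
    have h1 := ((Complex.ofRealCLM.hasDerivAt (x := y)).const_mul (Complex.I * s)).cexp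
    simp only [Complex.ofRealCLM_apply, Complex.ofReal_one, mul_one] at h1
    rwa [mul_comm (Complex.exp _)] at h1
  rw [intervalIntegral.integral_eq_sub_of_hasDerivAt h
    (Continuous.intervalIntegrable (by fun_prop) _ _)]
  simp

lemma norm_cexp_I_mul (s y : ℝ) : ‖Complex.exp (Complex.I * s * y)‖ = 1 := by
  rw [Complex.norm_exp]; simp

/-- The characteristic function of a law on `[0, ∞)` in terms of its tail. -/
lemma norm_charFun_sub_integral_tail_le (Q : Measure ℝ) [IsProbabilityMeasure Q]
    (hQ : ∀ᵐ x ∂Q, 0 ≤ x) (s : ℝ) {R : ℝ} (hR : 0 < R) :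
    ‖charFun Q s - 1 - ∫ y in (0 : ℝ)..R,
      Complex.I * s * Complex.exp (Complex.I * s * y) * (Q.real (Set.Ici y) : ℝ)‖
      ≤ 2 * Q.real (Set.Ici R) := by
  set f : ℝ → ℂ := fun y => Complex.I * s * Complex.exp (Complex.I * s * y) with hf
  have hfn : ∀ y, ‖f y‖ = |s| := by
    intro y; simp only [hf]; rw [norm_mul, norm_cexp_I_mul]; simp
  have hfc : Continuous f := by fun_prop
  -- By Fubini the truncated integral is the mean of `e^{is min(R, x)} - 1`. It differs from
  -- `e^{isx} - 1` only where `x ≥ R`, and there by at most `2`.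
  have hswap : ∫ y in (0 : ℝ)..R, f y * (Q.real (Set.Ici y) : ℝ) =
      ∫ x, (Complex.exp (Complex.I * s * (min R x : ℝ)) - 1) ∂Q := by
    have hK : Integrable (Function.uncurry fun (y x : ℝ) => (Set.Iic x).indicator f y)
        ((volume.restrict (Set.Ioc 0 R)).prod Q) := by
      refine Integrable.mono' (integrable_const |s|) ?_ (Eventually.of_forall ?_)
      · have : (Function.uncurry fun (y x : ℝ) => (Set.Iic x).indicator f y) =
            {p : ℝ × ℝ | p.1 ≤ p.2}.indicator fun p => f p.1 := by
          ext ⟨y, x⟩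
          simp [Set.indicator]
        rw [this]
        refine Measurable.aestronglyMeasurable (Measurable.indicator (by fun_prop) ?_)
        exact measurableSet_le measurable_fst measurable_snd
      · rintro ⟨y, x⟩
        refine (norm_indicator_le_norm_self _ _).trans (hfn y).le
    have h1 := integral_integral_swap hK
    have h2 : ∀ y, ∫ x, (Set.Iic x).indicator f y ∂Q = f y * (Q.real (Set.Ici y) : ℝ) := by
      intro y
      have : (fun x => (Set.Iic x).indicator f y) = (Set.Ici y).indicator fun _ => f y := by
        ext x; simp [Set.indicator]
      rw [this, integral_indicator measurableSet_Ici, setIntegral_const, Complex.real_smul,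
        mul_comm]
    have h3 : ∀ᵐ x ∂Q, ∫ y in Set.Ioc 0 R, (Set.Iic x).indicator f y =
        Complex.exp (Complex.I * s * (min R x : ℝ)) - 1 := by
      filter_upwards [hQ] with x hx
      rw [setIntegral_indicator measurableSet_Iic, Set.Ioc_inter_Iic,
        ← intervalIntegral.integral_of_le (le_min hR.le hx), integral_I_mul_cexp]
    rw [intervalIntegral.integral_of_le hR.le]
    simp_rw [h2] at h1
    rw [h1]
    exact integral_congr_ae h3
  have hi1 : Integrable (fun x : ℝ => Complex.exp (Complex.I * s * x) - 1) Q := by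
    refine Integrable.mono' (integrable_const 2) (Measurable.aestronglyMeasurable (by fun_prop))
      (Eventually.of_forall fun x => (norm_sub_le _ _).trans ?_)
    rw [norm_cexp_I_mul]; norm_num
  have hi2 : Integrable (fun x : ℝ => Complex.exp (Complex.I * s * (min R x : ℝ)) - 1) Q := by
    refine Integrable.mono' (integrable_const 2) (Measurable.aestronglyMeasurable (by fun_prop))
      (Eventually.of_forall fun x => (norm_sub_le _ _).trans ?_)
    rw [norm_cexp_I_mul]; norm_num
  have hphi : charFun Q s - 1 = ∫ x : ℝ, (Complex.exp (Complex.I * s * x) - 1) ∂Q := by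
    have hi : Integrable (fun x : ℝ => Complex.exp (Complex.I * s * x)) Q := by
      refine (hi1.add (integrable_const (1 : ℂ))).congr (Eventually.of_forall fun x => ?_)
      simp
    rw [integral_sub hi (integrable_const 1), charFun_apply_real]
    simp only [integral_const, probReal_univ, one_smul]
    congr 2
    ext x
    ring_nf
  change ‖_ - 1 - ∫ y in (0 : ℝ)..R, f y * (Q.real (Set.Ici y) : ℝ)‖ ≤ _
  rw [hphi, hswap, ← integral_sub hi1 hi2]
  have hle : ∀ x : ℝ, ‖Complex.exp (Complex.I * s * x) - 1 -
      (Complex.exp (Complex.I * s * (min R x : ℝ)) - 1)‖ ≤ (Set.Ici R).indicator (fun _ => 2) x := by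
    intro x
    rcases le_or_gt R x with h | h
    · rw [Set.indicator_of_mem (by exact h), sub_sub_sub_cancel_right]
      refine (norm_sub_le _ _).trans ?_
      rw [norm_cexp_I_mul, norm_cexp_I_mul]; norm_num
    · rw [min_eq_right h.le, sub_self, norm_zero]
      exact Set.indicator_nonneg (fun _ _ => by norm_num) _
  have := norm_integral_le_of_norm_le (μ := Q) ((integrable_const (2 : ℝ)).indicator measurableSet_Ici)
    (Eventually.of_forall hle)
  rwa [integral_indicator measurableSet_Ici, setIntegral_const, smul_eq_mul, mul_comm _ (2 : ℝ)] at this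

/-- Locally uniform convergence of the rescaled characteristic exponent. -/
lemma HasRegularlyVaryingTail.eventually_norm_charFun_sub_stableExponent_le {α : ℝ}
    (hα : α ∈ Set.Ioo (0 : ℝ) 1) {P : Measure ℝ} [IsProbabilityMeasure P]
    (hP : ∀ᵐ x ∂P, 0 ≤ x) (h : HasRegularlyVaryingTail α P) (K : ℝ) {ε : ℝ} (hε : 0 < ε) :
    ∀ᶠ N : ℕ in atTop, ∀ s : ℝ, |s| ≤ K →
      ‖N * (charFun P ((normalizer P N)⁻¹ * s) - 1) - stableExponent α s‖ ≤ ε := by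
  -- Two truncation errors occur: `2 N F(a_N R)`, tending to `2 R ^ (-α)`, and `2 R ^ (-α)`; this
  -- `R` makes their limiting total less than `ε`. The rest is at most `K` times the `L¹` distance
  -- of the weights, whatever `s`.
  obtain ⟨R, hRε, hR⟩ : ∃ R : ℝ, R ^ (-α) < ε / 4 ∧ 0 < R :=
    (((tendsto_rpow_neg_atTop hα.1).eventually_lt_const (by positivity)).and
      (eventually_gt_atTop 0)).exists
  have hB := (((h.tendsto_integral_tail hα hR).const_mul K).add
    ((h.tendsto_tail_normalizer_mul hR).const_mul 2)).add_const (2 * R ^ (-α))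
  filter_upwards [hB.eventually_le_const (show K * 0 + 2 * R ^ (-α) + 2 * R ^ (-α) < ε by linarith),
    h.tendsto_normalizer.eventually_gt_atTop 0] with N hN ha s hs
  refine le_trans ?_ hN
  set a := normalizer P N
  have hmeas : Measurable fun x : ℝ => a⁻¹ * x := measurable_const_mul _
  set Q : Measure ℝ := P.map fun x => a⁻¹ * x with hQ
  have : IsProbabilityMeasure Q := Measure.isProbabilityMeasure_map hmeas.aemeasurable
  have hQ0 : ∀ᵐ x ∂Q, 0 ≤ x := by
    rw [hQ, ae_map_iff hmeas.aemeasurable measurableSet_Ici]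
    filter_upwards [hP] with x hx
    positivity
  have hQt : ∀ y, Q.real (Set.Ici y) = P.real (Set.Ici (a * y)) := by
    intro y
    rw [hQ, map_measureReal_apply hmeas measurableSet_Ici]
    congr 1
    ext x
    simp only [Set.mem_preimage, Set.mem_Ici]
    rw [← div_eq_inv_mul, le_div_iff₀' ha]
  have hQc : charFun Q s = charFun P (a⁻¹ * s) := charFun_map_mul _ _
  set f : ℝ → ℂ := fun y => Complex.I * s * Complex.exp (Complex.I * s * y) with hf
  have hfn : ∀ y, ‖f y‖ = |s| := by
    intro y; simp only [hf]; rw [norm_mul, norm_cexp_I_mul]; simp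
  have hfm : Measurable f := by fun_prop
  have h1 := norm_charFun_sub_integral_tail_le Q hQ0 s hR
  have h2 := norm_stableExponent_sub_integral_le hα s hR
  simp only [hQt, hQc] at h1
  change ‖_ - ∫ y in (0 : ℝ)..R, f y * (P.real (Set.Ici (a * y)) : ℝ)‖ ≤ _ at h1
  change ‖_ - ∫ y in (0 : ℝ)..R, f y * (y ^ (-α) : ℝ)‖ ≤ _ at h2
  have hFm : Measurable fun y => P.real (Set.Ici (a * y)) :=
    ((antitone_measureReal_Ici P).measurable).comp (measurable_const_mul a)
  have i1' : IntervalIntegrable (fun y => P.real (Set.Ici (a * y))) volume 0 R := by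
    refine (intervalIntegrable_const (c := (1 : ℝ))).mono_fun hFm.aestronglyMeasurable
      (Eventually.of_forall fun y => ?_)
    change ‖P.real (Set.Ici (a * y))‖ ≤ ‖(1 : ℝ)‖
    rw [norm_one, Real.norm_of_nonneg measureReal_nonneg]
    exact measureReal_le_one
  have i2' : IntervalIntegrable (fun y : ℝ => y ^ (-α)) volume 0 R :=
    intervalIntegral.intervalIntegrable_rpow' (by linarith [hα.2])
  have hmul : ∀ g : ℝ → ℝ, Measurable g → IntervalIntegrable g volume 0 R →
      IntervalIntegrable (fun y => f y * (g y : ℝ)) volume 0 R := by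
    intro g hg hi
    refine (hi.const_mul |s|).mono_fun (Measurable.aestronglyMeasurable (by fun_prop))
      (Eventually.of_forall fun y => ?_)
    change ‖f y * (g y : ℂ)‖ ≤ ‖|s| * g y‖
    rw [norm_mul, hfn, norm_mul, Complex.norm_real, Real.norm_eq_abs |s|, abs_abs]
  have i1 := hmul _ hFm i1'
  have i2 := hmul (fun y => y ^ (-α)) (measurable_id.pow_const (-α)) i2'
  have h3 : N * (∫ y in (0 : ℝ)..R, f y * (P.real (Set.Ici (a * y)) : ℝ)) -
      (∫ y in (0 : ℝ)..R, f y * (y ^ (-α) : ℝ)) =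
      ∫ y in (0 : ℝ)..R, f y * ((N * P.real (Set.Ici (a * y)) - y ^ (-α) : ℝ) : ℂ) := by
    rw [← intervalIntegral.integral_const_mul, ← intervalIntegral.integral_sub (i1.const_mul _) i2]
    congr 1
    ext y
    push_cast
    ring
  have h4 : ‖∫ y in (0 : ℝ)..R, f y * ((N * P.real (Set.Ici (a * y)) - y ^ (-α) : ℝ) : ℂ)‖ ≤
      K * ∫ y in (0 : ℝ)..R, |N * P.real (Set.Ici (a * y)) - y ^ (-α)| := by
    rw [← intervalIntegral.integral_const_mul]
    refine intervalIntegral.norm_integral_le_of_norm_le hR.le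
      (Eventually.of_forall fun y _ => ?_) ((((i1'.const_mul _).sub i2').abs).const_mul _)
    rw [norm_mul, hfn, Complex.norm_real, Real.norm_eq_abs]
    gcongr
  have h5 : (N : ℂ) * (charFun P (a⁻¹ * s) - 1) - stableExponent α s =
      N * (charFun P (a⁻¹ * s) - 1 - ∫ y in (0 : ℝ)..R, f y * (P.real (Set.Ici (a * y)) : ℝ)) +
      (N * (∫ y in (0 : ℝ)..R, f y * (P.real (Set.Ici (a * y)) : ℝ)) -
        (∫ y in (0 : ℝ)..R, f y * (y ^ (-α) : ℝ))) -
      (stableExponent α s - ∫ y in (0 : ℝ)..R, f y * (y ^ (-α) : ℝ)) := by ring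
  rw [h5, h3]
  refine (norm_sub_le _ _).trans (add_le_add ((norm_add_le _ _).trans ?_) h2)
  rw [add_comm]
  refine add_le_add h4 ?_
  rw [norm_mul, Complex.norm_natCast]
  calc _ ≤ (N : ℝ) * (2 * P.real (Set.Ici (a * R))) := by gcongr
    _ = _ := by ring

/-! ### Products near `1` and Lévy's continuity theorem -/

lemma norm_prod_sub_prod_le_sum {ι : Type*} (s : Finset ι) {z w : ι → ℂ}
    (hz : ∀ i, ‖z i‖ ≤ 1) (hw : ∀ i, ‖w i‖ ≤ 1) :
    ‖∏ i ∈ s, z i - ∏ i ∈ s, w i‖ ≤ ∑ i ∈ s, ‖z i - w i‖ := by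
  classical
  induction s using Finset.induction_on with
  | empty => simp
  | insert i s hi ih =>
    rw [Finset.prod_insert hi, Finset.prod_insert hi, Finset.sum_insert hi]
    have e : z i * ∏ j ∈ s, z j - w i * ∏ j ∈ s, w j =
        (z i - w i) * ∏ j ∈ s, z j + w i * (∏ j ∈ s, z j - ∏ j ∈ s, w j) := by ring
    have hp : ‖∏ j ∈ s, z j‖ ≤ 1 := by
      rw [norm_prod]
      exact Finset.prod_le_one (fun _ _ => norm_nonneg _) fun j _ => hz j
    rw [e]
    refine (norm_add_le _ _).trans ?_
    rw [norm_mul, norm_mul]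
    exact add_le_add (mul_le_of_le_one_right (norm_nonneg _) hp)
      ((mul_le_of_le_one_left (norm_nonneg _) (hw i)).trans ih)

/-- A product of small perturbations of `1` is asymptotic to the exponential of their sum. -/
lemma tendsto_prod_one_add_of_tendsto_sum {u : (N : ℕ) → Fin N → ℂ} {A : ℂ} {C : ℝ}
    (hu1 : ∀ N k, ‖1 + u N k‖ ≤ 1) (hu : ∀ᶠ N : ℕ in atTop, ∀ k, ‖u N k‖ ≤ C / N)
    (hsum : Tendsto (fun N => ∑ k, u N k) atTop (𝓝 A)) :
    Tendsto (fun N => ∏ k, (1 + u N k)) atTop (𝓝 (Complex.exp A)) := by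
  have hexp : Tendsto (fun N => ∏ k, Complex.exp (u N k)) atTop (𝓝 (Complex.exp A)) := by
    simp_rw [← Complex.exp_sum]
    exact (Complex.continuous_exp.tendsto A).comp hsum
  -- `|1 + u| ≤ 1` forces `Re u ≤ 0`. Both products then have factors in the unit disc, and the `N`
  -- quadratic errors `(C / N) ^ 2` add up to `C * (C / N)`.
  have hw : ∀ N k, ‖Complex.exp (u N k)‖ ≤ 1 := by
    intro N k
    rw [Complex.norm_exp, Real.exp_le_one_iff]
    have := (Complex.re_le_norm (1 + u N k)).trans (hu1 N k)
    simp only [Complex.add_re, Complex.one_re] at this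
    linarith
  have hC : Tendsto (fun N : ℕ => C / (N : ℝ)) atTop (𝓝 0) := tendsto_const_div_atTop_nhds_zero_nat C
  have hC2 : Tendsto (fun N : ℕ => C * (C / (N : ℝ))) atTop (𝓝 0) := by simpa using hC.const_mul C
  have hdiff : Tendsto (fun N => ∏ k, (1 + u N k) - ∏ k, Complex.exp (u N k)) atTop (𝓝 0) := by
    refine squeeze_zero_norm' ?_ hC2
    filter_upwards [hu, hC.eventually_le_const one_pos, eventually_gt_atTop 0] with N h1 h2 h3
    refine (norm_prod_sub_prod_le_sum _ (hu1 N) (hw N)).trans ?_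
    have hb : ∀ k, ‖1 + u N k - Complex.exp (u N k)‖ ≤ (C / N) ^ 2 := by
      intro k
      rw [← norm_neg, show -(1 + u N k - Complex.exp (u N k)) =
        Complex.exp (u N k) - 1 - u N k by ring]
      refine (Complex.norm_exp_sub_one_sub_id_le ((h1 k).trans h2)).trans ?_
      exact pow_le_pow_left₀ (norm_nonneg _) (h1 k) 2
    refine (Finset.sum_le_sum fun k _ => hb k).trans (le_of_eq ?_)
    have hN : (N : ℝ) ≠ 0 := by exact_mod_cast h3.ne'
    simp only [Finset.sum_const, Finset.card_univ, Fintype.card_fin, nsmul_eq_mul]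
    field_simp
  simpa using hdiff.add hexp

/-- Existence part of Lévy's continuity theorem: a pointwise limit of characteristic functions that
is continuous at `0` is a characteristic function. -/
lemma exists_charFun_eq_of_tendsto_charFun {p : ℕ → ProbabilityMeasure ℝ} {f : ℝ → ℂ}
    (hf : ContinuousAt f 0)
    (h : ∀ t, Tendsto (fun n => charFun (p n : Measure ℝ) t) atTop (𝓝 (f t))) :
    ∃ q : ProbabilityMeasure ℝ, ∀ t, charFun (q : Measure ℝ) t = f t := by
  have ht : IsTightMeasureSet (Set.range fun n => (p n : Measure ℝ)) :=
    isTightMeasureSet_of_tendsto_charFun hf h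
  have hc : IsCompact (closure (Set.range p)) := by
    refine isCompact_closure_of_isTightMeasureSet ?_
    convert! ht using 1
    ext m
    simp
  -- A limit along a nonprincipal ultrafilter replaces the extraction of a subsequence in
  -- Prokhorov's theorem.
  obtain ⟨q, -, hq⟩ := hc.ultrafilter_le_nhds ((hyperfilter ℕ : Ultrafilter ℕ).map p)
    (by
      rw [le_principal_iff]
      refine mem_of_superset (Ultrafilter.mem_map.2 (univ_mem' fun n => ?_)) subset_closure
      exact Set.mem_range_self n)
  refine ⟨q, fun t => ?_⟩
  have hq' : Tendsto p (hyperfilter ℕ : Filter ℕ) (𝓝 q) := hq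
  rw [ProbabilityMeasure.tendsto_iff_forall_integral_rclike_tendsto ℂ] at hq'
  have h1 := hq' (BoundedContinuousFunction.innerProbChar t)
  simp_rw [← charFun_eq_integral_innerProbChar] at h1
  exact tendsto_nhds_unique h1 ((h t).mono_left (Nat.hyperfilter_le_atTop))

/-- The imaginary axis meets the branch cut only at `0`, where `α > 0` gives continuity. -/
lemma continuous_stableExponent {α : ℝ} (hα : 0 < α) : Continuous (stableExponent α) := by
  refine (continuous_const.mul (continuous_iff_continuousAt.2 fun s => ?_)).neg
  have h1 : ContinuousAt (fun z : ℂ => z ^ (α : ℂ)) (-(Complex.I * s)) :=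
    Complex.continuousAt_cpow_const_of_re_pos (by simp) (by simpa using hα)
  have h2 : ContinuousAt (fun s : ℝ => -(Complex.I * s)) s := by fun_prop
  exact ContinuousAt.comp (f := fun s : ℝ => -(Complex.I * s)) h1 h2

/-! ### Empirical measures of bounded arrays -/

lemma integral_empiricalMeasure {E : Type*} [NormedAddCommGroup E] [NormedSpace ℝ E]
    [CompleteSpace E] (G : (N : ℕ) → Fin N → ℝ) (N : ℕ) (f : ℝ → E) :
    ∫ x, f x ∂(empiricalMeasure G N : Measure ℝ) = (N : ℝ)⁻¹ • ∑ k, f (G N k) := by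
  have : (empiricalMeasure G N : Measure ℝ) =
      (N : ℝ≥0)⁻¹ • ∑ k : Fin N, Measure.dirac (G N k) := by
    rw [empiricalMeasure, FiniteMeasure.toMeasure_smul, FiniteMeasure.toMeasure_sum]
    rfl
  rw [this, integral_smul_nnreal_measure, integral_finsetSum_measure]
  · simp [NNReal.smul_def]
  · intro k _
    exact integrable_dirac (by simp)

/-- A bounded continuous function that is positive exactly where `|x| > M` has integral `0` under
every empirical measure, hence under `ν`. -/
lemma ae_abs_le_of_tendsto_empiricalMeasure {G : (N : ℕ) → Fin N → ℝ} {M : ℝ}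
    (hM : ∀ N k, |G N k| ≤ M) {ν : FiniteMeasure ℝ}
    (h : Tendsto (empiricalMeasure G) atTop (𝓝 ν)) : ∀ᵐ x ∂(ν : Measure ℝ), |x| ≤ M := by
  let f : BoundedContinuousFunction ℝ ℝ := BoundedContinuousFunction.ofNormedAddCommGroup
    (fun x => min 1 (max 0 (|x| - M))) (by fun_prop) 1 (fun x => by
      rw [Real.norm_of_nonneg (le_min zero_le_one (le_max_left _ _))]
      exact min_le_left _ _)
  have hf : ∀ x, f x = min 1 (max 0 (|x| - M)) := fun _ => rfl
  have h1 := FiniteMeasure.tendsto_iff_forall_integral_tendsto.1 h f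
  have h2 : ∀ N, ∫ x, f x ∂(empiricalMeasure G N : Measure ℝ) = 0 := by
    intro N
    rw [integral_empiricalMeasure, Finset.sum_eq_zero, smul_zero]
    intro k _
    rw [hf, max_eq_left (by linarith [hM N k])]
    simp
  simp_rw [h2] at h1
  have h3 := tendsto_nhds_unique h1 tendsto_const_nhds
  have h0 : 0 ≤ (f : ℝ → ℝ) := fun x => le_min zero_le_one (le_max_left _ _)
  rw [integral_eq_zero_iff_of_nonneg h0 (f.integrable _)] at h3
  filter_upwards [h3] with x hx
  by_contra! hlt
  have : 0 < f x := by
    rw [hf]; exact lt_min one_pos (lt_max_of_lt_right (by linarith))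
  exact this.ne' hx

/-- Clipping the argument to `[-M, M]` makes `g` bounded and changes no integral, as all the
measures live there. -/
lemma tendsto_average_of_tendsto_empiricalMeasure {G : (N : ℕ) → Fin N → ℝ} {M : ℝ}
    (hM : ∀ N k, |G N k| ≤ M) {ν : FiniteMeasure ℝ}
    (h : Tendsto (empiricalMeasure G) atTop (𝓝 ν)) {g : ℝ → ℂ} (hg : Continuous g) :
    Tendsto (fun N : ℕ => (N : ℝ)⁻¹ • ∑ k, g (G N k)) atTop (𝓝 (∫ x, g x ∂(ν : Measure ℝ))) := by
  have hclip : ∀ x, |x| ≤ M → max (-M) (min M x) = x := by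
    intro x hx
    rw [abs_le] at hx
    rw [min_eq_right hx.2, max_eq_right hx.1]
  obtain ⟨B, hB⟩ := isCompact_Icc.exists_bound_of_continuousOn (s := Set.Icc (-|M|) |M|)
    hg.continuousOn
  let f : BoundedContinuousFunction ℝ ℂ := BoundedContinuousFunction.ofNormedAddCommGroup
    (fun x => g (max (-M) (min M x))) (by fun_prop) B (fun x => hB _ (by
      rw [Set.mem_Icc]
      constructor
      · exact (neg_le_neg (le_abs_self M)).trans (le_max_left _ _)
      · exact max_le (neg_le_abs M) ((min_le_left _ _).trans (le_abs_self M))))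
  have hf : ∀ x, |x| ≤ M → f x = g x := fun x hx => congrArg g (hclip x hx)
  have h1 := (FiniteMeasure.tendsto_iff_forall_integral_rclike_tendsto ℂ).1 h f
  rw [integral_congr_ae (g := g) ((ae_abs_le_of_tendsto_empiricalMeasure hM h).mono hf)] at h1
  refine h1.congr fun N => ?_
  rw [integral_empiricalMeasure]
  congr 1
  exact Finset.sum_congr rfl fun k _ => hf _ (hM N k)

/-! ### The limiting characteristic function of the normalized sum -/

lemma charFun_map_normalizedSum {Ω : Type*} [MeasurableSpace Ω] {μ : Measure Ω}
    [IsProbabilityMeasure μ] {X : ℕ → Ω → ℝ} (hX_indep : iIndepFun X μ)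
    (hX_ident : ∀ k, IdentDistrib (X k) (X 0) μ μ) (a : ℕ → ℝ) (G : (N : ℕ) → Fin N → ℝ)
    (N : ℕ) (t : ℝ) :
    charFun (μ.map (normalizedSum a G X N)) t =
      ∏ k, charFun (μ.map (X 0)) ((a N)⁻¹ * (t * G N k)) := by
  have hfun : normalizedSum a G X N = fun ω => ∑ k : Fin N, ((a N)⁻¹ * G N k) * X k ω := by
    ext ω
    rw [normalizedSum, Finset.mul_sum]
    exact Finset.sum_congr rfl fun k _ => by ring
  have hind : iIndepFun (fun (k : Fin N) ω => ((a N)⁻¹ * G N k) * X k ω) μ :=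
    (hX_indep.precomp (g := fun k : Fin N => (k : ℕ)) Fin.val_injective).comp
      (fun k x => ((a N)⁻¹ * G N k) * x) fun k => measurable_const_mul _
  have hm : ∀ k : Fin N, AEMeasurable (fun ω => ((a N)⁻¹ * G N k) * X k ω) μ :=
    fun k => (hX_ident k).aemeasurable_fst.const_mul _
  rw [hfun, hind.charFun_map_fun_sum_eq_prod hm, Finset.prod_apply]
  refine Finset.prod_congr rfl fun k _ => ?_
  rw [charFun_map_mul_comp (hX_ident k).aemeasurable_fst, (hX_ident k).map_eq]
  congr 1
  ring

lemma tendsto_charFun_normalizedSum {Ω : Type*} [MeasurableSpace Ω] {μ : Measure Ω}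
    [IsProbabilityMeasure μ] {α : ℝ} (hα : α ∈ Set.Ioo (0 : ℝ) 1) {X : ℕ → Ω → ℝ}
    (hX_nonneg : ∀ᵐ ω ∂μ, 0 ≤ X 0 ω) (hX_indep : iIndepFun X μ)
    (hX_ident : ∀ k, IdentDistrib (X k) (X 0) μ μ)
    (hX_tail : HasRegularlyVaryingTail α (μ.map (X 0)))
    {G : (N : ℕ) → Fin N → ℝ} {M : ℝ} (hM : ∀ N k, |G N k| ≤ M) {ν : FiniteMeasure ℝ}
    (hG : Tendsto (empiricalMeasure G) atTop (𝓝 ν)) (t : ℝ) :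
    Tendsto (fun N => charFun (μ.map (normalizedSum (normalizer (μ.map (X 0))) G X N)) t) atTop
      (𝓝 (Complex.exp (∫ x, stableExponent α (t * x) ∂(ν : Measure ℝ)))) := by
  set P := μ.map (X 0) with hPdef
  have hX0 := (hX_ident 0).aemeasurable_fst
  have : IsProbabilityMeasure P := Measure.isProbabilityMeasure_map hX0
  have hP : ∀ᵐ x ∂P, 0 ≤ x := (ae_map_iff hX0 measurableSet_Ici).2 hX_nonneg
  set u : (N : ℕ) → Fin N → ℂ :=
    fun N k => charFun P ((normalizer P N)⁻¹ * (t * G N k)) - 1 with hu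
  have hK : ∀ N k, |t * G N k| ≤ |t| * M := fun N k => by
    rw [abs_mul]; exact mul_le_mul_of_nonneg_left (hM N k) (abs_nonneg t)
  have hcont := continuous_stableExponent hα.1
  obtain ⟨B, hB⟩ := isCompact_Icc.exists_bound_of_continuousOn
    (s := Set.Icc (-(|t| * M)) (|t| * M)) hcont.continuousOn
  have hconv := fun {ε : ℝ} (hε : 0 < ε) =>
    hX_tail.eventually_norm_charFun_sub_stableExponent_le hα hP (|t| * M) hε
  have hprod : ∀ N, charFun (μ.map (normalizedSum (normalizer P) G X N)) t =
      ∏ k, (1 + u N k) := by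
    intro N
    rw [charFun_map_normalizedSum hX_indep hX_ident]
    simp [hu, hPdef]
  simp_rw [hprod]
  -- `B` bounds the exponent on the range of `t G_{N,k}`; the `1` is the approximation error.
  refine tendsto_prod_one_add_of_tendsto_sum (C := B + 1) ?_ ?_ ?_
  · intro N k
    simpa [hu] using norm_charFun_le_one _
  · filter_upwards [hconv one_pos, eventually_gt_atTop 0] with N hN hN0 k
    have hNp : (0 : ℝ) < N := by exact_mod_cast hN0
    rw [le_div_iff₀' hNp]
    have h1 := hN _ (hK N k)
    have h2 := hB _ (abs_le.1 (hK N k))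
    calc (N : ℝ) * ‖u N k‖ = ‖(N : ℂ) * u N k‖ := by rw [norm_mul, Complex.norm_natCast]
      _ = ‖stableExponent α (t * G N k) + (N * u N k - stableExponent α (t * G N k))‖ := by
        congr 1; ring
      _ ≤ B + 1 := (norm_add_le _ _).trans (add_le_add h2 h1)
  · have havg := tendsto_average_of_tendsto_empiricalMeasure hM hG
      (g := fun x => stableExponent α (t * x)) (by fun_prop)
    have hdiff : Tendsto (fun N => ∑ k, u N k -
        (N : ℝ)⁻¹ • ∑ k, stableExponent α (t * G N k)) atTop (𝓝 0) := by
      rw [Metric.tendsto_atTop']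
      intro ε hε
      obtain ⟨n, hn⟩ := eventually_atTop.1 ((hconv (half_pos hε)).and (eventually_gt_atTop 0))
      refine ⟨n, fun N hN => ?_⟩
      obtain ⟨h1, h2⟩ := hn N hN.le
      have hNp : (0 : ℝ) < N := by exact_mod_cast h2
      have hNc : (N : ℂ) ≠ 0 := by exact_mod_cast h2.ne'
      have e : ∑ k, u N k - (N : ℝ)⁻¹ • ∑ k, stableExponent α (t * G N k) =
          (N : ℂ)⁻¹ * ∑ k, (N * u N k - stableExponent α (t * G N k)) := by
        have e' : ∑ k, (N * u N k - stableExponent α (t * G N k)) =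
            N * ∑ k, u N k - ∑ k, stableExponent α (t * G N k) := by
          rw [Finset.mul_sum, ← Finset.sum_sub_distrib]
        rw [e', Complex.real_smul]
        push_cast
        field_simp
      rw [dist_zero_right, e, norm_mul, norm_inv, Complex.norm_natCast]
      have h3 : ‖∑ k, (N * u N k - stableExponent α (t * G N k))‖ ≤ N * (ε / 2) := by
        refine (norm_sum_le_of_le _ fun k _ => h1 _ (hK N k)).trans ?_
        simp
      calc (N : ℝ)⁻¹ * _ ≤ (N : ℝ)⁻¹ * (N * (ε / 2)) := by gcongr
        _ = ε / 2 := by field_simp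
        _ < ε := half_lt_self hε
    simpa using hdiff.add havg

/-! ### Polar form of the exponent and the stable parameters -/

lemma inv_stableConst {α : ℝ} (hα : α ∈ Set.Ioo (0 : ℝ) 1) :
    (stableConst α)⁻¹ = Real.Gamma (1 - α) * Real.cos (Real.pi * α / 2) := by
  have h : 1 - α ≠ 0 := by linarith [hα.2]
  rw [stableConst, inv_inv, show 2 - α = (1 - α) + 1 by ring, Real.Gamma_add_one h]
  field_simp

lemma cos_pi_mul_div_two_pos {α : ℝ} (hα : α ∈ Set.Ioo (0 : ℝ) 1) :
    0 < Real.cos (Real.pi * α / 2) := by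
  have := Real.pi_pos
  refine Real.cos_pos_of_mem_Ioo ⟨?_, ?_⟩
  · have := mul_pos this hα.1
    linarith
  · have := mul_lt_mul_of_pos_left hα.2 this
    linarith

lemma inv_stableConst_pos {α : ℝ} (hα : α ∈ Set.Ioo (0 : ℝ) 1) : 0 < (stableConst α)⁻¹ := by
  rw [inv_stableConst hα]
  exact mul_pos (Real.Gamma_pos_of_pos (by linarith [hα.2])) (cos_pi_mul_div_two_pos hα)

lemma stableExponent_eq {α : ℝ} (hα : α ∈ Set.Ioo (0 : ℝ) 1) (s : ℝ) :
    stableExponent α s = -(((stableConst α)⁻¹ * |s| ^ α : ℝ) : ℂ) *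
      (1 - Complex.I * ((Real.sign s * Real.tan (Real.pi * α / 2) : ℝ) : ℂ)) := by
  have hc := (cos_pi_mul_div_two_pos hα).ne'
  -- Used with `r = |s|` and `ε = -sign s`, since the argument of `-i s` is `ε π / 2`. Factoring out
  -- the cosine produces the tangent.
  have key : ∀ r ε : ℝ, 0 < r →
      Complex.exp ((Real.log r + ε * (Real.pi / 2 * Complex.I)) * α) =
      ((r ^ α * Real.cos (Real.pi * α / 2) : ℝ) : ℂ) * ((Real.cos (ε * (Real.pi * α / 2)) /
        Real.cos (Real.pi * α / 2) : ℝ) +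
        Complex.I * (Real.sin (ε * (Real.pi * α / 2)) / Real.cos (Real.pi * α / 2) : ℝ)) := by
    intro r ε hr
    have hcc : (Real.cos (Real.pi * α / 2) : ℂ) ≠ 0 := by exact_mod_cast hc
    rw [Real.rpow_def_of_pos hr, show (Real.log r + ε * (Real.pi / 2 * Complex.I)) * (α : ℂ) =
      ((Real.log r * α : ℝ) : ℂ) + ((ε * (Real.pi * α / 2) : ℝ) : ℂ) * Complex.I by
        push_cast; ring, Complex.exp_add, Complex.exp_mul_I, ← Complex.ofReal_exp,
      ← Complex.ofReal_cos, ← Complex.ofReal_sin]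
    simp only [Complex.ofReal_mul, Complex.ofReal_div]
    generalize ((Real.cos (Real.pi * α / 2) : ℝ) : ℂ) = c at hcc ⊢
    field_simp
  have hG : Complex.Gamma (1 - α) = (Real.Gamma (1 - α) : ℝ) := by
    rw [← Complex.Gamma_ofReal]; push_cast; rfl
  rcases lt_trichotomy s 0 with hs | rfl | hs
  · have hlog : Complex.log (-(Complex.I * s)) =
        Real.log (-s) + (1 : ℝ) * (Real.pi / 2 * Complex.I) := by
      rw [show -(Complex.I * s) = ((-s : ℝ) : ℂ) * Complex.I by push_cast; ring,
        Complex.log_ofReal_mul (neg_pos.2 hs) Complex.I_ne_zero, Complex.log_I]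
      simp
    have hne : -(Complex.I * (s : ℂ)) ≠ 0 := by simpa using hs.ne
    rw [stableExponent, Complex.cpow_def_of_ne_zero hne, hlog, key _ _ (neg_pos.2 hs), hG,
      inv_stableConst hα, abs_of_neg hs, Real.sign_of_neg hs, Real.tan_eq_sin_div_cos, one_mul,
      div_self hc]
    push_cast
    ring
  · have : (α : ℂ) ≠ 0 := by exact_mod_cast hα.1.ne'
    simp [stableExponent, Complex.zero_cpow this, Real.zero_rpow hα.1.ne']
  · have hlog : Complex.log (-(Complex.I * s)) =
        Real.log s + (-1 : ℝ) * (Real.pi / 2 * Complex.I) := by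
      rw [show -(Complex.I * s) = (s : ℂ) * -Complex.I by ring,
        Complex.log_ofReal_mul hs (neg_ne_zero.2 Complex.I_ne_zero), Complex.log_neg_I]
      push_cast
      ring
    have hne : -(Complex.I * (s : ℂ)) ≠ 0 := by simpa using hs.ne'
    rw [stableExponent, Complex.cpow_def_of_ne_zero hne, hlog, key _ _ hs, hG,
      inv_stableConst hα, abs_of_pos hs, Real.sign_of_pos hs, Real.tan_eq_sin_div_cos, neg_one_mul,
      Real.cos_neg, Real.sin_neg, div_self hc]
    push_cast
    ring

lemma Real.sign_mul_eq (x y : ℝ) : Real.sign (x * y) = Real.sign x * Real.sign y := by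
  rcases lt_trichotomy x 0 with hx | rfl | hx <;> rcases lt_trichotomy y 0 with hy | rfl | hy <;>
    simp [Real.sign_of_neg, Real.sign_of_pos, mul_pos_of_neg_of_neg, mul_neg_of_neg_of_pos,
      mul_neg_of_pos_of_neg, *]

lemma Real.abs_sign_le_one (x : ℝ) : |Real.sign x| ≤ 1 := by
  rcases Real.sign_apply_eq x with h | h | h <;> simp [h]

lemma Real.measurable_sign : Measurable Real.sign := by
  unfold Real.sign
  exact Measurable.ite measurableSet_Iio measurable_const
    (Measurable.ite measurableSet_Ioi measurable_const measurable_const)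

lemma integrable_abs_rpow {ν : Measure ℝ} [IsFiniteMeasure ν] {M α : ℝ} (hα : 0 < α)
    (hν : ∀ᵐ x ∂ν, |x| ≤ M) : Integrable (fun x : ℝ => |x| ^ α) ν := by
  refine Integrable.mono' (integrable_const (M ^ α)) (Measurable.aestronglyMeasurable (by fun_prop))
    (hν.mono fun x hx => ?_)
  rw [Real.norm_of_nonneg (by positivity)]
  exact Real.rpow_le_rpow (abs_nonneg x) hx hα.le

lemma integrable_abs_rpow_mul_sign {ν : Measure ℝ} [IsFiniteMeasure ν] {M α : ℝ} (hα : 0 < α)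
    (hν : ∀ᵐ x ∂ν, |x| ≤ M) : Integrable (fun x : ℝ => |x| ^ α * Real.sign x) ν := by
  refine (integrable_abs_rpow hα hν).mono ?_ (Eventually.of_forall fun x => ?_)
  · exact ((measurable_norm.pow_const α).mul Real.measurable_sign).aestronglyMeasurable
  · rw [norm_mul]
    exact mul_le_of_le_one_right (norm_nonneg _) (Real.abs_sign_le_one x)

lemma integral_abs_rpow_pos {ν : Measure ℝ} [IsProbabilityMeasure ν] {M α : ℝ} (hα : 0 < α)
    (hν : ∀ᵐ x ∂ν, |x| ≤ M) (hne : ν ≠ Measure.dirac 0) : 0 < ∫ x, |x| ^ α ∂ν := by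
  refine lt_of_le_of_ne (integral_nonneg fun x => by positivity) fun h0 => hne ?_
  rw [eq_comm, integral_eq_zero_iff_of_nonneg (fun x => by positivity)
    (integrable_abs_rpow hα hν)] at h0
  have h1 : (id : ℝ → ℝ) =ᵐ[ν] fun _ => 0 := by
    filter_upwards [h0] with x hx
    simpa using ((Real.rpow_eq_zero (abs_nonneg x) hα.ne').1 hx)
  rw [← Measure.map_id (μ := ν), Measure.map_congr h1, Measure.map_const]
  simp

/-- Both `|tx| ^ α` and `sign (tx)` factor, so `ν` enters only through the two moments defining `σ`
and `β`. -/
lemma integral_stableExponent {ν : Measure ℝ} [IsFiniteMeasure ν] {M α : ℝ}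
    (hα : α ∈ Set.Ioo (0 : ℝ) 1) (hν : ∀ᵐ x ∂ν, |x| ≤ M) (t : ℝ) :
    ∫ x, stableExponent α (t * x) ∂ν = -(((stableConst α)⁻¹ * |t| ^ α : ℝ) : ℂ) *
      (((∫ x, |x| ^ α ∂ν : ℝ) : ℂ) - Complex.I * ((Real.sign t * Real.tan (Real.pi * α / 2) *
        ∫ x, |x| ^ α * Real.sign x ∂ν : ℝ) : ℂ)) := by
  have e : ∀ x, stableExponent α (t * x) = -(((stableConst α)⁻¹ * |t| ^ α : ℝ) : ℂ) *
      (((|x| ^ α : ℝ) : ℂ) - (Complex.I * (Real.sign t * Real.tan (Real.pi * α / 2) : ℝ)) *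
        ((|x| ^ α * Real.sign x : ℝ) : ℂ)) := by
    intro x
    rw [stableExponent_eq hα, abs_mul, Real.mul_rpow (abs_nonneg _) (abs_nonneg _),
      Real.sign_mul_eq]
    push_cast
    ring
  simp_rw [e]
  rw [integral_const_mul, integral_sub (integrable_abs_rpow hα.1 hν).ofReal
    ((integrable_abs_rpow_mul_sign hα.1 hν).ofReal.const_mul _), integral_const_mul,
    integral_complex_ofReal, integral_complex_ofReal]
  push_cast
  ring

lemma continuousAt_integral_stableExponent {ν : Measure ℝ} [IsFiniteMeasure ν] {M α : ℝ}
    (hα : 0 < α) (hν : ∀ᵐ x ∂ν, |x| ≤ M) :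
    ContinuousAt (fun t => ∫ x, stableExponent α (t * x) ∂ν) 0 := by
  have hc := continuous_stableExponent hα
  obtain ⟨B, hB⟩ := isCompact_Icc.exists_bound_of_continuousOn (s := Set.Icc (-M) M)
    hc.continuousOn
  refine continuousAt_of_dominated (bound := fun _ => B)
    (Eventually.of_forall fun t => Continuous.aestronglyMeasurable (by fun_prop)) ?_
    (integrable_const B) (Eventually.of_forall fun x => Continuous.continuousAt (by fun_prop))
  filter_upwards [Metric.closedBall_mem_nhds (0 : ℝ) one_pos] with t ht
  filter_upwards [hν] with x hx
  refine hB _ (abs_le.1 ?_)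
  rw [mem_closedBall_zero_iff, Real.norm_eq_abs] at ht
  rw [abs_mul]
  exact (mul_le_of_le_one_left (abs_nonneg x) ht).trans hx

/-! ### The limit theorem -/

theorem theorem9p1 {Ω : Type*} [MeasurableSpace Ω] (μ : Measure Ω) [IsProbabilityMeasure μ]
    (α : ℝ) (hα : α ∈ Set.Ioo (0 : ℝ) 1)
    (X : ℕ → Ω → ℝ)
    (hX_nonneg : ∀ k, ∀ᵐ ω ∂μ, 0 ≤ X k ω)
    (hX_indep : iIndepFun X μ)
    (hX_ident : ∀ k, IdentDistrib (X k) (X 0) μ μ)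
    (hX_tail : HasRegularlyVaryingTail α (μ.map (X 0)))
    (G : (N : ℕ) → Fin N → ℝ)
    (hG_bdd : ∃ M : ℝ, ∀ (N : ℕ) (k : Fin N), |G N k| ≤ M)
    (ν : ProbabilityMeasure ℝ)
    (hG_conv : Tendsto (empiricalMeasure G) atTop (𝓝 ν.toFiniteMeasure)) :
    ((ν : Measure ℝ) ≠ Measure.dirac 0 →
      ∃ σ β : ℝ,
        σ ^ α = (stableConst α)⁻¹ * ∫ x, |x| ^ α ∂(ν : Measure ℝ) ∧
        β = (∫ x, |x| ^ α * Real.sign x ∂(ν : Measure ℝ)) / ∫ x, |x| ^ α ∂(ν : Measure ℝ) ∧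
        ∃ P : ProbabilityMeasure ℝ, IsStableLaw α σ β 0 (P : Measure ℝ) ∧
          TendstoInDistribution (normalizedSum (normalizer (μ.map (X 0))) G X) atTop
            (id : ℝ → ℝ) (fun _ => μ) (P : Measure ℝ)) ∧
    ((ν : Measure ℝ) = Measure.dirac 0 →
      TendstoInDistribution (normalizedSum (normalizer (μ.map (X 0))) G X) atTop
        (id : ℝ → ℝ) (fun _ => μ) (Measure.dirac (0 : ℝ))) := by
  obtain ⟨M, hM⟩ := hG_bdd
  have hν : ∀ᵐ x ∂(ν : Measure ℝ), |x| ≤ M := ae_abs_le_of_tendsto_empiricalMeasure hM hG_conv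
  have hS : ∀ N, AEMeasurable (normalizedSum (normalizer (μ.map (X 0))) G X N) μ := fun N =>
    (Finset.aemeasurable_fun_sum (s := (Finset.univ : Finset (Fin N))) fun k _ =>
      (hX_ident k).aemeasurable_fst.const_mul (G N k)).const_mul _
  have hlim : ∀ t : ℝ,
      Tendsto (fun N => charFun (μ.map (normalizedSum (normalizer (μ.map (X 0))) G X N)) t) atTop
        (𝓝 (Complex.exp (∫ x, stableExponent α (t * x) ∂(ν : Measure ℝ)))) := fun t =>
    tendsto_charFun_normalizedSum hα (hX_nonneg 0) hX_indep hX_ident hX_tail hM hG_conv t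
  have hdist : ∀ (Q : Measure ℝ) [IsProbabilityMeasure Q],
      (∀ t, charFun Q t = Complex.exp (∫ x, stableExponent α (t * x) ∂(ν : Measure ℝ))) →
      TendstoInDistribution (normalizedSum (normalizer (μ.map (X 0))) G X) atTop
        (id : ℝ → ℝ) (fun _ => μ) Q := by
    intro Q _ hQ
    refine ⟨hS, aemeasurable_id, ProbabilityMeasure.tendsto_iff_tendsto_charFun.2 fun t => ?_⟩
    simpa [hQ t] using hlim t
  refine ⟨fun hne => ?_, fun heq => hdist _ fun t => ?_⟩
  · set m := ∫ x, |x| ^ α ∂(ν : Measure ℝ) with hm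
    set j := ∫ x, |x| ^ α * Real.sign x ∂(ν : Measure ℝ) with hj
    have hm0 : 0 < m := integral_abs_rpow_pos hα.1 hν hne
    have hcm : 0 < (stableConst α)⁻¹ * m := mul_pos (inv_stableConst_pos hα) hm0
    have hσ : (((stableConst α)⁻¹ * m) ^ α⁻¹) ^ α = (stableConst α)⁻¹ * m :=
      Real.rpow_inv_rpow hcm.le hα.1.ne'
    have hjm : |j| ≤ m := by
      refine (abs_integral_le_integral_abs).trans (integral_mono
        (integrable_abs_rpow_mul_sign hα.1 hν).abs (integrable_abs_rpow hα.1 hν) fun x => ?_)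
      simp only [abs_mul, abs_of_nonneg (Real.rpow_nonneg (abs_nonneg x) α)]
      exact mul_le_of_le_one_right (by positivity) (Real.abs_sign_le_one x)
    have hβ : j / m ∈ Set.Icc (-1 : ℝ) 1 := by
      rw [Set.mem_Icc, ← abs_le, abs_div, abs_of_pos hm0]
      exact div_le_one_of_le₀ hjm hm0.le
    have hval : ∀ t : ℝ, ∫ x, stableExponent α (t * x) ∂(ν : Measure ℝ) =
        -(((((stableConst α)⁻¹ * m) ^ α⁻¹) ^ α * |t| ^ α : ℝ) : ℂ) *
        (1 - Complex.I * ((j / m * Real.sign t * Real.tan (Real.pi * α / 2) : ℝ) : ℂ))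
          + Complex.I * ((0 * t : ℝ) : ℂ) := by
      intro t
      have hmc : (m : ℂ) ≠ 0 := by exact_mod_cast hm0.ne'
      rw [integral_stableExponent hα hν, hσ, ← hm, ← hj]
      simp only [Complex.ofReal_mul, Complex.ofReal_div, Complex.ofReal_zero, zero_mul, mul_zero,
        add_zero]
      field_simp
    -- The stable law itself is constructed here, as a limit of the laws of `S_N`.
    obtain ⟨P, hP⟩ := exists_charFun_eq_of_tendsto_charFun
      (p := fun N => ⟨_, Measure.isProbabilityMeasure_map (hS N)⟩) (f := fun t =>
        Complex.exp (∫ x, stableExponent α (t * x) ∂(ν : Measure ℝ)))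
      (Complex.continuous_exp.continuousAt.comp (continuousAt_integral_stableExponent hα.1 hν)) hlim
    refine ⟨_, _, hσ, rfl, P, ?_, hdist _ hP⟩
    exact
      { alpha_pos := hα.1
        alpha_lt_two := by linarith [hα.2]
        alpha_ne_one := hα.2.ne
        scale_pos := Real.rpow_pos_of_pos hcm _
        skewness_mem := hβ
        isProbabilityMeasure := inferInstance
        charFun_eq := fun t => by rw [hP t, hval t] }
  · have h0 : stableExponent α 0 = 0 := by
      have : (α : ℂ) ≠ 0 := by exact_mod_cast hα.1.ne'
      simp [stableExponent, Complex.zero_cpow this]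
    rw [heq]
    simp [h0]
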